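/- Let $n\ge 1$ be an integer, let $\mathbb D=\{z\in\mathbb C:|z|<1\}$, and let $f:\mathbb D\to\mathbb C$ be an analytic function that is exactly $n$-to-one as a map of $\mathbb D$ onto its image $f(\mathbb D)$; that is, for every $w\in f(\mathbb D)$ the equation $f(z)=w$ has exactly $n$ solutions $z\in\mathbb D$, counted with multiplicity (the multiplicity of a solution $z_0$ being the order of the zero of $f-w$ at $z_0$). Then $f(\mathbb D)$ is simply connected, and $f'$ has exactly $n-1$ zeros in $\mathbb D$, counted with multiplicity. -/

import Mathlib

/-- `g` (analytic on `S`) has exactly `k` zeros in `S`, counted with multiplicity: its zeros in `S`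
form a finite set, and their orders add up to `k`. -/
def HasExactlyZeros (g : ℂ → ℂ) (S : Set ℂ) (k : ℕ) : Prop :=
  ∃ Z : Finset ℂ, (∀ z, z ∈ Z ↔ z ∈ S ∧ g z = 0) ∧ ∑ z ∈ Z, analyticOrderAt g z = (k : ℕ∞)

/-- `f` (analytic on `S`) is exactly `n`-to-one as a map of `S` onto `f '' S`: every value that `f`
takes on `S` is taken exactly `n` times in `S`, counted with multiplicity. -/
def IsExactlyNToOneOn (f : ℂ → ℂ) (S : Set ℂ) (n : ℕ) : Prop :=
  ∀ w ∈ f '' S, HasExactlyZeros (fun z => f z - w) S n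

open Complex Metric Set Filter Topology

/-! The map `f` is a finite Blaschke product `b` of degree `n` followed by a conformal map. Put `w₀
= f 0` and factor `f - w₀ = b * exp h`, where `b` carries the `n` zeros. Summing `h` over fibres
gives a function `H` on the image, analytic by the weighted argument principle
(`analyticOnNhd_fiberSum`). Set `φ w = (w - w₀) * exp (-H w / n)`, so that `φ ∘ f = b * q` with `q`
zero-free, and `φ w ^ n` is the product of `b` over the fibre above `w`.

Constancy of the fibre count makes `f` proper onto its image (`exists_fiber_subset_ball`, by
Rouché). Hence a whole fibre tends to the unit circle as soon as one of its points does. There `|b|`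
tends to 1, so `|φ ∘ f|` and `|q|` do too, and the maximum principle for `q` and `1 / q` gives `q =
c` with `|c| = 1`.

Now `φ ∘ f = c * b`, and `b` takes each value in the disc exactly `n` times. A single fibre of `f`
already uses up all `n`, so `φ` is injective with nonvanishing derivative and maps the image
conformally onto the disc. Thus the image is simply connected, and `f'` has the zeros of `b'`. These
number `n - 1`, since `z * b' / b` is positive on the unit circle. -/

/-! ### Argument principle and Rouché's theorem. -/

theorem AnalyticOnNhd.exists_eq_prod_mul {F : ℂ → ℂ} {U : Set ℂ} (hF : AnalyticOnNhd ℂ F U)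
    (Z : Finset ℂ) (hZ : ∀ a ∈ Z, a ∈ U) (hord : ∀ a ∈ Z, analyticOrderAt F a ≠ ⊤) :
    ∃ g : ℂ → ℂ, AnalyticOnNhd ℂ g U ∧ (∀ a ∈ Z, g a ≠ 0) ∧
      ∀ z, F z = (∏ a ∈ Z, (z - a) ^ analyticOrderNatAt F a) * g z := by
  classical
  induction Z using Finset.induction_on with
  | empty => exact ⟨F, hF, by simp, by simp⟩
  | insert a s ha ih =>
    obtain ⟨g, hg, hg0, hFg⟩ := ih (fun b hb => hZ b (Finset.mem_insert_of_mem hb))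
      (fun b hb => hord b (Finset.mem_insert_of_mem hb))
    have haU : a ∈ U := hZ a (Finset.mem_insert_self a s)
    have hP : AnalyticAt ℂ (fun z => ∏ b ∈ s, (z - b) ^ analyticOrderNatAt F b) a := by
      fun_prop
    have hP0 : (∏ b ∈ s, (a - b) ^ analyticOrderNatAt F b) ≠ 0 :=
      Finset.prod_ne_zero_iff.2 fun b hb =>
        pow_ne_zero _ (sub_ne_zero.2 fun h => ha (h ▸ hb))
    have hordg : analyticOrderAt F a = analyticOrderAt g a := by
      have h1 : F = (fun z => ∏ b ∈ s, (z - b) ^ analyticOrderNatAt F b) * g := funext hFg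
      conv_lhs => rw [h1]
      rw [analyticOrderAt_mul hP (hg a haU), hP.analyticOrderAt_eq_zero.2 hP0, zero_add]
    have hnat : analyticOrderNatAt F a = analyticOrderNatAt g a := by
      simp only [analyticOrderNatAt, hordg]
    have htop : analyticOrderAt g a ≠ ⊤ := hordg ▸ hord a (Finset.mem_insert_self a s)
    obtain ⟨k, hk, hk0, hgk⟩ := (hg a haU).analyticOrderAt_ne_top.1 htop
    rw [← hnat] at hgk
    set m := analyticOrderNatAt F a with hm
    refine ⟨Function.update (fun z => g z / (z - a) ^ m) a (k a), ?_, ?_, ?_⟩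
    · intro z hz
      by_cases hza : z = a
      · subst hza
        refine hk.congr ?_
        filter_upwards [hgk] with y hy
        by_cases hyz : y = z
        · subst hyz; simp
        · have : (y - z) ^ m ≠ 0 := pow_ne_zero _ (sub_ne_zero.2 hyz)
          rw [Function.update_of_ne hyz, hy, smul_eq_mul]
          field_simp
      · have h1 : AnalyticAt ℂ (fun z => g z / (z - a) ^ m) z :=
          (hg z hz).div (by fun_prop) (pow_ne_zero _ (sub_ne_zero.2 hza))
        refine h1.congr ?_
        filter_upwards [isOpen_ne.mem_nhds hza] with y hy
        rw [Function.update_of_ne hy]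
    · intro b hb
      by_cases hba : b = a
      · subst hba; simpa using hk0
      · rw [Function.update_of_ne hba]
        exact div_ne_zero (hg0 b (Finset.mem_of_mem_insert_of_ne hb hba))
          (pow_ne_zero _ (sub_ne_zero.2 hba))
    · intro z
      rw [Finset.prod_insert ha, hFg z]
      by_cases hza : z = a
      · subst hza
        have := hgk.self_of_nhds
        simp only [smul_eq_mul] at this
        rw [this, Function.update_self]; ring
      · have : (z - a) ^ m ≠ 0 := pow_ne_zero _ (sub_ne_zero.2 hza)
        rw [Function.update_of_ne hza, ← hm]
        field_simp

/-- Once the zeros are factored out, the logarithmic derivative is a sum of simple poles plus a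
holomorphic term, and Cauchy's formula evaluates each piece. The weight `h` is what later turns
fibre sums into integrals. -/
theorem circleIntegral_mul_logDeriv {F h : ℂ → ℂ} {r : ℝ} (hr : 0 < r)
    (hF : AnalyticOnNhd ℂ F (closedBall 0 r)) (hh : AnalyticOnNhd ℂ h (closedBall 0 r))
    (Z : Finset ℂ) (hZ : ∀ z, z ∈ Z ↔ z ∈ ball 0 r ∧ F z = 0)
    (hord : ∀ a ∈ Z, analyticOrderAt F a ≠ ⊤) (hs : ∀ z ∈ sphere 0 r, F z ≠ 0) :
    ∮ z in C(0, r), h z * logDeriv F z =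
      2 * Real.pi * I * ∑ a ∈ Z, analyticOrderNatAt F a * h a := by
  obtain ⟨g, hg, hgZ, hFg⟩ := hF.exists_eq_prod_mul Z
    (fun a ha => ball_subset_closedBall ((hZ a).1 ha).1) hord
  have hg0 : ∀ z ∈ closedBall (0 : ℂ) r, g z ≠ 0 := by
    intro z hz h0
    by_cases hzZ : z ∈ Z
    · exact hgZ z hzZ h0
    · have hFz : F z = 0 := by rw [hFg, h0, mul_zero]
      rcases (mem_closedBall.1 hz).lt_or_eq with hlt | heq
      · exact hzZ ((hZ z).2 ⟨mem_ball.2 hlt, hFz⟩)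
      · exact hs z (mem_sphere.2 heq) hFz
  have hzne : ∀ z ∈ sphere (0 : ℂ) r, ∀ a ∈ Z, z - a ≠ 0 := by
    intro z hz a ha h0
    exact hs z hz ((sub_eq_zero.1 h0) ▸ ((hZ a).1 ha).2)
  have hlog : EqOn (fun z => h z * logDeriv F z)
      (fun z => (∑ a ∈ Z, analyticOrderNatAt F a * ((z - a)⁻¹ • h z)) + h z * logDeriv g z)
      (sphere 0 r) := by
    intro z hz
    have hP0 : ∀ a ∈ Z, (z - a) ^ analyticOrderNatAt F a ≠ 0 := fun a ha =>
      pow_ne_zero _ (hzne z hz a ha)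
    have hFeq : F = fun z => (∏ a ∈ Z, (z - a) ^ analyticOrderNatAt F a) * g z := funext hFg
    have h1 : logDeriv F z = (∑ a ∈ Z, analyticOrderNatAt F a * (z - a)⁻¹) + logDeriv g z := by
      conv_lhs => rw [hFeq]
      rw [logDeriv_mul z (Finset.prod_ne_zero_iff.2 hP0) (hg0 z (sphere_subset_closedBall hz))
        (by fun_prop) (hg z (sphere_subset_closedBall hz)).differentiableAt]
      congr 1
      have := logDeriv_prod (s := Z) (f := fun a z => (z - a) ^ analyticOrderNatAt F a)
        (x := z) hP0 (fun a ha => by fun_prop)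
      rw [this]
      refine Finset.sum_congr rfl fun a ha => ?_
      rw [logDeriv_fun_pow (f := fun z => z - a) (by fun_prop), logDeriv_apply]
      simp
    simp only [h1, mul_add, Finset.mul_sum, smul_eq_mul]
    congr 1
    exact Finset.sum_congr rfl fun a _ => by ring
  have hhd : DifferentiableOn ℂ h (closedBall 0 r) := hh.differentiableOn
  have hlg : DifferentiableOn ℂ (fun z => h z * logDeriv g z) (closedBall 0 r) := fun z hz =>
    ((hh z hz).mul ((hg z hz).deriv.div (hg z hz) (hg0 z hz))).differentiableAt.differentiableWithinAt
  have hc : ∀ a ∈ Z, ContinuousOn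
      (fun z => (analyticOrderNatAt F a : ℂ) * ((z - a)⁻¹ • h z)) (sphere 0 r) := by
    intro a ha
    have h1 : ContinuousOn (fun z => (z - a)⁻¹) (sphere 0 r) :=
      ContinuousOn.inv₀ (by fun_prop) fun z hz => hzne z hz a ha
    exact continuousOn_const.mul (h1.smul (hhd.continuousOn.mono sphere_subset_closedBall))
  rw [circleIntegral.integral_congr hr.le hlog, circleIntegral.integral_add]
  · have h0 : ∮ z in C(0, r), h z * logDeriv g z = 0 :=
      (hlg.diffContOnCl_ball subset_rfl).circleIntegral_eq_zero hr.le
    rw [h0, add_zero, circleIntegral.integral_fun_sum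
      (fun a ha => (hc a ha).circleIntegrable hr.le), Finset.mul_sum]
    refine Finset.sum_congr rfl fun a ha => ?_
    rw [circleIntegral.integral_const_mul,
      hhd.circleIntegral_sub_inv_smul ((hZ a).1 ha).1]
    simp only [smul_eq_mul]; ring
  · exact (continuousOn_finsetSum _ hc).circleIntegrable hr.le
  · exact (hlg.continuousOn.mono sphere_subset_closedBall).circleIntegrable hr.le

theorem analyticOrderAt_ne_top_of_sum_eq {F : ℂ → ℂ} {Z : Finset ℂ} {k : ℕ}
    (h : ∑ z ∈ Z, analyticOrderAt F z = k) : ∀ a ∈ Z, analyticOrderAt F a ≠ ⊤ := by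
  intro a ha htop
  have : analyticOrderAt F a ≤ k := h ▸ Finset.single_le_sum (fun _ _ => zero_le) ha
  rw [htop, top_le_iff] at this
  exact ENat.natCast_ne_top k this

theorem sum_analyticOrderNatAt_eq {F : ℂ → ℂ} {Z : Finset ℂ} {k : ℕ}
    (h : ∑ z ∈ Z, analyticOrderAt F z = k) : ∑ z ∈ Z, analyticOrderNatAt F z = k := by
  have h1 : ((∑ z ∈ Z, analyticOrderNatAt F z : ℕ) : ℕ∞) = k := by
    rw [← h]
    push_cast
    exact Finset.sum_congr rfl fun a ha =>
      Nat.cast_analyticOrderNatAt (analyticOrderAt_ne_top_of_sum_eq h a ha)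
  exact_mod_cast h1

theorem HasExactlyZeros.circleIntegral_logDeriv {F : ℂ → ℂ} {r : ℝ} {k : ℕ} (hr : 0 < r)
    (hF : AnalyticOnNhd ℂ F (closedBall 0 r)) (hk : HasExactlyZeros F (ball 0 r) k)
    (hs : ∀ z ∈ sphere 0 r, F z ≠ 0) :
    ∮ z in C(0, r), logDeriv F z = 2 * Real.pi * I * k := by
  obtain ⟨Z, hZ, hsum⟩ := hk
  have := circleIntegral_mul_logDeriv (h := fun _ => 1) hr hF
    (fun _ _ => analyticAt_const) Z hZ (analyticOrderAt_ne_top_of_sum_eq hsum) hs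
  simp only [one_mul, mul_one] at this
  rw [this, ← sum_analyticOrderNatAt_eq hsum]
  push_cast
  rfl

/-- **Rouché's theorem** on a disc, for functions whose quotient on the boundary circle avoids
the closed negative real axis. -/
theorem HasExactlyZeros.eq_of_div_mem_slitPlane {F G : ℂ → ℂ} {r : ℝ} {j k : ℕ} (hr : 0 < r)
    (hF : AnalyticOnNhd ℂ F (closedBall 0 r)) (hG : AnalyticOnNhd ℂ G (closedBall 0 r))
    (hj : HasExactlyZeros F (ball 0 r) j) (hk : HasExactlyZeros G (ball 0 r) k)
    (hFG : ∀ z ∈ sphere 0 r, F z / G z ∈ slitPlane) : j = k := by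
  have hF0 : ∀ z ∈ sphere 0 r, F z ≠ 0 := fun z hz h0 => by
    have := hFG z hz
    simp [h0] at this
  have hG0 : ∀ z ∈ sphere 0 r, G z ≠ 0 := fun z hz h0 => by
    have := hFG z hz
    simp [h0] at this
  have hd : ∀ z ∈ sphere 0 r, HasDerivAt (fun z => log (F z / G z))
      (logDeriv F z - logDeriv G z) z := by
    intro z hz
    have hzc := sphere_subset_closedBall hz
    have h1 := (hF z hzc).differentiableAt
    have h2 := (hG z hzc).differentiableAt
    have h3 := (h1.hasDerivAt.div h2.hasDerivAt (hG0 z hz)).clog (hFG z hz)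
    refine h3.congr_deriv ?_
    have := hF0 z hz
    have := hG0 z hz
    simp only [logDeriv_apply, Pi.div_apply]
    field_simp
  -- The integrand has the single-valued primitive `log (F / G)` along the circle.
  have h0 : ∮ z in C(0, r), (logDeriv F z - logDeriv G z) = 0 :=
    circleIntegral.integral_eq_zero_of_hasDerivWithinAt hr.le
      fun z hz => (hd z hz).hasDerivWithinAt
  have hcont : ∀ {H : ℂ → ℂ}, AnalyticOnNhd ℂ H (closedBall 0 r) →
      (∀ z ∈ sphere 0 r, H z ≠ 0) → CircleIntegrable (logDeriv H) 0 r := by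
    intro H hH hH0
    refine ContinuousOn.circleIntegrable hr.le fun z hz => ?_
    have hzc := sphere_subset_closedBall hz
    exact ((hH z hzc).deriv.div (hH z hzc) (hH0 z hz)).continuousAt.continuousWithinAt
  rw [circleIntegral.integral_sub (hcont hF hF0) (hcont hG hG0),
    hj.circleIntegral_logDeriv hr hF hF0, hk.circleIntegral_logDeriv hr hG hG0, sub_eq_zero] at h0
  exact_mod_cast mul_left_cancel₀ two_pi_I_ne_zero h0

/-! ### Properness of `f` and analyticity of fibre sums. -/

theorem differentiableAt_intervalIntegral_div_sub {C Φ : ℝ → ℂ} (hC : Continuous C)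
    (hΦ : Continuous Φ) (a b : ℝ) {w₀ : ℂ} {δ : ℝ} (hδ : 0 < δ) (h : ∀ θ, δ ≤ ‖Φ θ - w₀‖) :
    DifferentiableAt ℂ (fun w => ∫ θ in a..b, C θ / (Φ θ - w)) w₀ := by
  -- Half of the distance is kept on the half-size ball, which gives the dominating bound for the
  -- derivative.
  have hb : ∀ θ, ∀ x ∈ ball w₀ (δ / 2), δ / 2 ≤ ‖Φ θ - x‖ := by
    intro θ x hx
    have h1 := h θ
    have h2 : ‖Φ θ - w₀‖ ≤ ‖Φ θ - x‖ + ‖x - w₀‖ := by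
      simpa using norm_add_le (Φ θ - x) (x - w₀)
    have h3 := mem_ball_iff_norm.1 hx
    linarith
  have hne : ∀ θ, ∀ x ∈ ball w₀ (δ / 2), Φ θ - x ≠ 0 := fun θ x hx =>
    norm_pos_iff.1 ((half_pos hδ).trans_le (hb θ x hx))
  have hcont : ∀ x ∈ ball w₀ (δ / 2), Continuous fun θ => C θ / (Φ θ - x) := fun x hx =>
    hC.div (hΦ.sub continuous_const) fun θ => hne θ x hx
  have hw₀ : w₀ ∈ ball w₀ (δ / 2) := mem_ball_self (half_pos hδ)
  refine (intervalIntegral.hasDerivAt_integral_of_dominated_loc_of_deriv_le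
    (F := fun w θ => C θ / (Φ θ - w)) (F' := fun w θ => C θ / (Φ θ - w) ^ 2)
    (bound := fun θ => ‖C θ‖ / (δ / 2) ^ 2) (ball_mem_nhds w₀ (half_pos hδ)) ?_
    ((hcont w₀ hw₀).intervalIntegrable _ _) ?_ ?_ ?_ ?_).2.differentiableAt
  · filter_upwards [ball_mem_nhds w₀ (half_pos hδ)] with x hx
    exact (hcont x hx).aestronglyMeasurable
  · exact (hC.div ((hΦ.sub continuous_const).pow 2)
      fun θ => pow_ne_zero _ (hne θ w₀ hw₀)).aestronglyMeasurable
  · refine .of_forall fun θ _ x hx => ?_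
    rw [norm_div, norm_pow]
    have := hb θ x hx
    gcongr
  · exact (hC.norm.div_const _).intervalIntegrable _ _
  · refine .of_forall fun θ _ x hx => ?_
    have h1 := ((hasDerivAt_const x (C θ)).div ((hasDerivAt_id x).const_sub (Φ θ)) (hne θ x hx))
    refine h1.congr_deriv ?_
    simp

theorem analyticAt_circleIntegral_div_sub {g F : ℂ → ℂ} {r : ℝ} (hr : 0 ≤ r)
    (hg : ContinuousOn g (sphere 0 r)) (hF : ContinuousOn F (sphere 0 r)) {w₀ : ℂ}
    (hw₀ : w₀ ∉ F '' sphere 0 r) :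
    AnalyticAt ℂ (fun w => ∮ z in C(0, r), g z / (F z - w)) w₀ := by
  have hK : IsClosed (F '' sphere 0 r) := ((isCompact_sphere 0 r).image_of_continuousOn hF).isClosed
  have hmem : ∀ θ, circleMap 0 r θ ∈ sphere (0 : ℂ) r := circleMap_mem_sphere 0 hr
  rw [analyticAt_iff_eventually_differentiableAt]
  filter_upwards [hK.isOpen_compl.mem_nhds hw₀] with w hw
  obtain ⟨δ, hδ, hball⟩ := Metric.isOpen_iff.1 hK.isOpen_compl w hw
  have := differentiableAt_intervalIntegral_div_sub
    (C := fun θ => deriv (circleMap 0 r) θ * g (circleMap 0 r θ))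
    (Φ := fun θ => F (circleMap 0 r θ))
    (by
      simp only [deriv_circleMap]
      exact ((continuous_circleMap 0 r).mul continuous_const).mul
        (hg.comp_continuous (continuous_circleMap 0 r) hmem))
    (hF.comp_continuous (continuous_circleMap 0 r) hmem) 0 (2 * Real.pi) (w₀ := w) hδ
    (fun θ => by
      by_contra! hlt
      exact hball (mem_ball_iff_norm.2 hlt) (mem_image_of_mem F (hmem θ)))
  simpa only [circleIntegral, smul_eq_mul, mul_div_assoc] using this

/-- The sum of `h` over the fibre of `f` in `S` above `w`, counted with multiplicity. -/
noncomputable def fiberSum (f h : ℂ → ℂ) (S : Set ℂ) (w : ℂ) : ℂ :=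
  ∑ᶠ z ∈ {z | z ∈ S ∧ f z = w}, analyticOrderNatAt (fun z => f z - w) z * h z

theorem fiberSum_eq_sum {f h : ℂ → ℂ} {S : Set ℂ} {w : ℂ} {Z : Finset ℂ}
    (hZ : ∀ z, z ∈ Z ↔ z ∈ S ∧ f z - w = 0) :
    fiberSum f h S w = ∑ z ∈ Z, analyticOrderNatAt (fun z => f z - w) z * h z := by
  have : {z | z ∈ S ∧ f z = w} = (Z : Set ℂ) := by
    ext z
    simp [hZ, sub_eq_zero]
  rw [fiberSum, this, finsum_mem_coe_finset]

section

variable {n : ℕ} {f : ℂ → ℂ}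

/-- A circle enclosing the fibre above `w₀` encloses, by Rouché, `n` points of each nearby nonempty
fibre. Since `n` is the full count, nothing is left outside. This is properness in local form. -/
theorem IsExactlyNToOneOn.exists_fiber_subset_ball
    (hf : AnalyticOnNhd ℂ f (ball 0 1)) (hfn : IsExactlyNToOneOn f (ball 0 1) n) {w₀ : ℂ}
    (hw₀ : w₀ ∈ f '' ball 0 1) :
    ∃ r : ℝ, 0 < r ∧ r < 1 ∧ w₀ ∉ f '' sphere 0 r ∧
      ∀ᶠ w in 𝓝 w₀, w ∉ f '' sphere 0 r ∧ ∀ z ∈ ball (0 : ℂ) 1, f z = w → z ∈ ball (0 : ℂ) r := by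
  classical
  obtain ⟨Z, hZ, hsum⟩ := hfn w₀ hw₀
  have hev : ∀ᶠ r in 𝓝[<] (1 : ℝ), r ∈ Ioo (0 : ℝ) 1 ∧ ∀ z ∈ Z, ‖z‖ < r := by
    refine Filter.Eventually.and (Ioo_mem_nhdsLT one_pos) ((eventually_all_finset Z).2 fun z hz => ?_)
    exact mem_nhdsWithin_of_mem_nhds (lt_mem_nhds (mem_ball_zero_iff.1 ((hZ z).1 hz).1))
  obtain ⟨r, ⟨hr0, hr1⟩, hZr⟩ := hev.exists
  have hsub : closedBall (0 : ℂ) r ⊆ ball 0 1 := closedBall_subset_ball hr1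
  have hcont : ContinuousOn f (sphere 0 r) := fun z hz =>
    (hf z (hsub (sphere_subset_closedBall hz))).continuousAt.continuousWithinAt
  have hK : IsClosed (f '' sphere 0 r) :=
    ((isCompact_sphere 0 r).image_of_continuousOn hcont).isClosed
  have hw₀K : w₀ ∉ f '' sphere 0 r := by
    rintro ⟨z, hz, hzw⟩
    have h1 := hZr z ((hZ z).2 ⟨hsub (sphere_subset_closedBall hz), sub_eq_zero.2 hzw⟩)
    exact h1.ne (mem_sphere_zero_iff_norm.1 hz)
  obtain ⟨δ, hδ, hball⟩ := Metric.isOpen_iff.1 hK.isOpen_compl w₀ hw₀K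
  refine ⟨r, hr0, hr1, hw₀K, ?_⟩
  filter_upwards [ball_mem_nhds w₀ hδ] with w hw
  refine ⟨hball hw, fun z hz hzw => ?_⟩
  obtain ⟨Y, hY, hYsum⟩ := hfn w ⟨z, hz, hzw⟩
  have han : ∀ v, AnalyticOnNhd ℂ (fun z => f z - v) (closedBall 0 r) := fun v x hx =>
    (hf x (hsub hx)).sub analyticAt_const
  have h1 : HasExactlyZeros (fun z => f z - w₀) (ball 0 r) n := by
    refine ⟨Z, fun x => ?_, hsum⟩
    rw [hZ]
    refine ⟨fun hx => ⟨mem_ball_zero_iff.2 (hZr x ((hZ x).2 hx)), hx.2⟩,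
      fun hx => ⟨ball_subset_ball hr1.le hx.1, hx.2⟩⟩
  have h2 : HasExactlyZeros (fun z => f z - w) (ball 0 r)
      (∑ x ∈ Y with x ∈ ball (0 : ℂ) r, analyticOrderNatAt (fun z => f z - w) x) := by
    refine ⟨Y.filter (· ∈ ball (0 : ℂ) r), fun x => ?_, ?_⟩
    · rw [Finset.mem_filter, hY]
      exact ⟨fun hx => ⟨hx.2, hx.1.2⟩, fun hx => ⟨⟨ball_subset_ball hr1.le hx.1, hx.2⟩, hx.1⟩⟩
    · push_cast
      exact Finset.sum_congr rfl fun a ha => (Nat.cast_analyticOrderNatAt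
        (analyticOrderAt_ne_top_of_sum_eq hYsum a (Finset.mem_filter.1 ha).1)).symm
  -- On the circle the quotient lies within distance less than 1 of the point 1.
  have h3 := h2.eq_of_div_mem_slitPlane hr0 (han w) (han w₀) h1 (by
    intro x hx
    have hlt : ‖w - w₀‖ < ‖f x - w₀‖ := by
      refine (mem_ball_iff_norm.1 hw).trans_le ?_
      by_contra! hlt
      exact hball (mem_ball_iff_norm.2 hlt) (mem_image_of_mem f hx)
    have hpos : f x - w₀ ≠ 0 := norm_pos_iff.1 ((norm_nonneg _).trans_lt hlt)
    have : (f x - w) / (f x - w₀) = 1 + -((w - w₀) / (f x - w₀)) := by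
      field_simp; ring
    rw [this]
    refine mem_slitPlane_of_norm_lt_one ?_
    rwa [norm_neg, norm_div, div_lt_one (norm_pos_iff.2 hpos)])
  by_contra hzr
  have h4 := sum_analyticOrderNatAt_eq hYsum
  rw [← Finset.sum_filter_add_sum_filter_not Y (· ∈ ball (0 : ℂ) r), h3, Nat.add_eq_left,
    Finset.sum_eq_zero_iff] at h4
  have hzY : z ∈ Y := (hY z).2 ⟨hz, sub_eq_zero.2 hzw⟩
  have h5 := h4 z (Finset.mem_filter.2 ⟨hzY, hzr⟩)
  have h6 : analyticOrderAt (fun z => f z - w) z = 0 := by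
    rw [← Nat.cast_analyticOrderNatAt (analyticOrderAt_ne_top_of_sum_eq hYsum z hzY), h5]
    rfl
  exact analyticOrderAt_ne_zero.2
    ⟨(hf z hz).sub analyticAt_const, sub_eq_zero.2 hzw⟩ h6

theorem IsExactlyNToOneOn.isOpen_image
    (hf : AnalyticOnNhd ℂ f (ball 0 1)) (hfn : IsExactlyNToOneOn f (ball 0 1) n) :
    IsOpen (f '' ball 0 1) := by
  rcases hf.is_constant_or_isOpen (convex_ball 0 1).isPreconnected with ⟨w, hw⟩ | h
  · exfalso
    have h0 : (0 : ℂ) ∈ ball (0 : ℂ) 1 := mem_ball_self one_pos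
    obtain ⟨Z, hZ, hsum⟩ := hfn (f 0) ⟨0, h0, rfl⟩
    refine analyticOrderAt_ne_top_of_sum_eq hsum 0 ((hZ 0).2 ⟨h0, sub_self _⟩)
      (analyticOrderAt_eq_top.2 ?_)
    filter_upwards [isOpen_ball.mem_nhds h0] with z hz
    rw [hw z hz, hw 0 h0, sub_self]
  · exact h _ subset_rfl isOpen_ball

theorem IsExactlyNToOneOn.analyticOnNhd_fiberSum
    (hf : AnalyticOnNhd ℂ f (ball 0 1)) (hfn : IsExactlyNToOneOn f (ball 0 1) n) {h : ℂ → ℂ}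
    (hh : AnalyticOnNhd ℂ h (ball 0 1)) :
    AnalyticOnNhd ℂ (fiberSum f h (ball 0 1)) (f '' ball 0 1) := by
  intro w₀ hw₀
  obtain ⟨r, hr0, hr1, hw₀K, hev⟩ := hfn.exists_fiber_subset_ball hf hw₀
  have hsub : closedBall (0 : ℂ) r ⊆ ball 0 1 := closedBall_subset_ball hr1
  have hsub' : sphere (0 : ℂ) r ⊆ ball 0 1 := sphere_subset_closedBall.trans hsub
  have h1 : AnalyticAt ℂ (fun w => (2 * Real.pi * I)⁻¹ *
      ∮ z in C(0, r), h z * deriv f z / (f z - w)) w₀ := by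
    refine analyticAt_const.mul (analyticAt_circleIntegral_div_sub hr0.le ?_ ?_ hw₀K)
    · exact fun z hz => ((hh z (hsub' hz)).mul
        (hf z (hsub' hz)).deriv).continuousAt.continuousWithinAt
    · exact fun z hz => (hf z (hsub' hz)).continuousAt.continuousWithinAt
  refine h1.congr ?_
  filter_upwards [hev, (hfn.isOpen_image hf).mem_nhds hw₀] with w hw hwΩ
  obtain ⟨Z, hZ, hsum⟩ := hfn w hwΩ
  have h2 := circleIntegral_mul_logDeriv (F := fun z => f z - w) hr0
    (fun z hz => (hf z (hsub hz)).sub analyticAt_const) (fun z hz => hh z (hsub hz)) Z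
    (fun z => (hZ z).trans ⟨fun hz => ⟨hw.2 z hz.1 (sub_eq_zero.1 hz.2), hz.2⟩,
      fun hz => ⟨ball_subset_ball hr1.le hz.1, hz.2⟩⟩)
    (analyticOrderAt_ne_top_of_sum_eq hsum)
    (fun z hz h0 => hw.1 ⟨z, hz, sub_eq_zero.1 h0⟩)
  rw [fiberSum_eq_sum hZ]
  simp only [logDeriv_apply, deriv_sub_const, ← mul_div_assoc] at h2
  rw [h2, inv_mul_cancel_left₀ two_pi_I_ne_zero]

/-- Properness made global: the image of the closed disc of radius `η` is compact, so finitely many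
of the local radii suffice for all fibres meeting that disc. -/
theorem IsExactlyNToOneOn.exists_norm_lt_of_norm_lt
    (hf : AnalyticOnNhd ℂ f (ball 0 1)) (hfn : IsExactlyNToOneOn f (ball 0 1) n) {η : ℝ}
    (hη : η < 1) :
    ∃ r : ℝ, r < 1 ∧ ∀ z ∈ ball (0 : ℂ) 1, ∀ z' ∈ ball (0 : ℂ) 1, r < ‖z‖ → f z' = f z →
      η < ‖z'‖ := by
  have hsub : closedBall (0 : ℂ) η ⊆ ball 0 1 := closedBall_subset_ball hη
  have hK : IsCompact (f '' closedBall 0 η) :=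
    (isCompact_closedBall 0 η).image_of_continuousOn fun z hz =>
      (hf z (hsub hz)).continuousAt.continuousWithinAt
  suffices H : ∃ r : ℝ, r < 1 ∧ ∀ w ∈ f '' closedBall 0 η, ∀ z ∈ ball (0 : ℂ) 1, f z = w →
      ‖z‖ < r by
    obtain ⟨r, hr, h⟩ := H
    refine ⟨r, hr, fun z hz z' hz' hzr hzz => ?_⟩
    by_contra! hle
    exact (h (f z') ⟨z', mem_closedBall_zero_iff.2 hle, rfl⟩ z hz hzz.symm).not_gt hzr
  refine hK.induction_on (p := fun s => ∃ r : ℝ, r < 1 ∧ ∀ w ∈ s, ∀ z ∈ ball (0 : ℂ) 1, f z = w →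
      ‖z‖ < r) ⟨0, one_pos, by simp⟩ ?_ ?_ ?_
  · rintro s t hst ⟨r, hr, h⟩
    exact ⟨r, hr, fun w hw => h w (hst hw)⟩
  · rintro s t ⟨r, hr, h⟩ ⟨r', hr', h'⟩
    refine ⟨max r r', max_lt hr hr', fun w hw z hz hzw => lt_max_iff.2 ?_⟩
    exact hw.imp (fun hw => h w hw z hz hzw) (fun hw => h' w hw z hz hzw)
  · rintro w₀ ⟨z₀, hz₀, rfl⟩
    obtain ⟨r, -, hr1, -, hev⟩ := hfn.exists_fiber_subset_ball hf ⟨z₀, hsub hz₀, rfl⟩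
    refine ⟨_, mem_nhdsWithin_of_mem_nhds hev, r, hr1, fun w hw z hz hzw => ?_⟩
    exact mem_ball_zero_iff.1 (hw.2 z hz hzw)

end

/-! ### Zero counts, logarithms and boundary behaviour. -/

/-- Infinitely many zeros would accumulate in the closed disc and force `F` to vanish on the circle
as well. -/
theorem exists_hasExactlyZeros_ball {F : ℂ → ℂ} {r : ℝ} (hr : 0 < r)
    (hF : AnalyticOnNhd ℂ F (closedBall 0 r)) (hs : ∀ z ∈ sphere 0 r, F z ≠ 0) :
    ∃ k, HasExactlyZeros F (ball 0 r) k := by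
  have hpre : IsPreconnected (closedBall (0 : ℂ) r) := (convex_closedBall 0 r).isPreconnected
  obtain ⟨p, hp⟩ : (sphere (0 : ℂ) r).Nonempty := NormedSpace.sphere_nonempty.2 hr.le
  have hpc := sphere_subset_closedBall hp
  have hfin : {z | z ∈ ball (0 : ℂ) r ∧ F z = 0}.Finite := by
    by_contra hinf
    obtain ⟨x, hx, hacc⟩ := Set.Infinite.exists_accPt_of_subset_isCompact hinf
      (isCompact_closedBall (0 : ℂ) r) (fun z hz => ball_subset_closedBall hz.1)
    have hfreq : ∃ᶠ z in 𝓝[≠] x, F z = 0 :=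
      (accPt_iff_frequently_nhdsNE.1 hacc).mono fun z hz => hz.2
    exact hs p hp (hF.eqOn_zero_of_preconnected_of_frequently_eq_zero hpre hx hfreq hpc)
  have htop : ∀ z ∈ closedBall (0 : ℂ) r, analyticOrderAt F z ≠ ⊤ := fun z hz =>
    hF.analyticOrderAt_ne_top_of_isPreconnected hpre hpc hz (by
      rw [((hF p hpc).analyticOrderAt_eq_zero).2 (hs p hp)]
      exact ENat.zero_ne_top)
  refine ⟨∑ z ∈ hfin.toFinset, analyticOrderNatAt F z, hfin.toFinset, fun z => by simp, ?_⟩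
  push_cast
  refine Finset.sum_congr rfl fun z hz => (Nat.cast_analyticOrderNatAt (htop z ?_)).symm
  exact ball_subset_closedBall ((hfin.mem_toFinset.1 hz).1)

theorem HasExactlyZeros.mul {F G : ℂ → ℂ} {S : Set ℂ} {j k : ℕ}
    (hF : AnalyticOnNhd ℂ F S) (hG : AnalyticOnNhd ℂ G S)
    (hj : HasExactlyZeros F S j) (hk : HasExactlyZeros G S k) :
    HasExactlyZeros (fun z => F z * G z) S (j + k) := by
  classical
  obtain ⟨Y, hY, hYs⟩ := hj
  obtain ⟨Z, hZ, hZs⟩ := hk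
  refine ⟨Y ∪ Z, fun z => ?_, ?_⟩
  · rw [Finset.mem_union, hY, hZ, mul_eq_zero]
    tauto
  · have hS : ∀ z ∈ Y ∪ Z, z ∈ S := fun z hz =>
      (Finset.mem_union.1 hz).elim (fun h => ((hY z).1 h).1) (fun h => ((hZ z).1 h).1)
    have h1 : ∀ z ∈ Y ∪ Z, analyticOrderAt (fun z => F z * G z) z =
        analyticOrderAt F z + analyticOrderAt G z := fun z hz =>
      analyticOrderAt_mul (hF z (hS z hz)) (hG z (hS z hz))
    rw [Finset.sum_congr rfl h1, Finset.sum_add_distrib]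
    push_cast
    rw [← hYs, ← hZs]
    congr 1
    · refine (Finset.sum_subset Finset.subset_union_left fun z hz hzY => ?_).symm
      exact ((hF z (hS z hz)).analyticOrderAt_eq_zero).2 fun h0 => hzY ((hY z).2 ⟨hS z hz, h0⟩)
    · refine (Finset.sum_subset Finset.subset_union_right fun z hz hzZ => ?_).symm
      exact ((hG z (hS z hz)).analyticOrderAt_eq_zero).2 fun h0 => hzZ ((hZ z).2 ⟨hS z hz, h0⟩)

theorem HasExactlyZeros.of_eqOn_mul {F G u : ℂ → ℂ} {S : Set ℂ} {k : ℕ} (hS : IsOpen S)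
    (hG : AnalyticOnNhd ℂ G S) (hu : AnalyticOnNhd ℂ u S) (hu0 : ∀ z ∈ S, u z ≠ 0)
    (hFG : ∀ z ∈ S, F z = G z * u z) (hF : HasExactlyZeros F S k) : HasExactlyZeros G S k := by
  obtain ⟨Z, hZ, hsum⟩ := hF
  refine ⟨Z, fun z => (hZ z).trans (and_congr_right fun hz => ?_), ?_⟩
  · rw [hFG z hz, mul_eq_zero, or_iff_left (hu0 z hz)]
  · rw [← hsum]
    refine Finset.sum_congr rfl fun z hz => ?_
    have hzS := ((hZ z).1 hz).1
    have h1 : F =ᶠ[𝓝 z] G * u := by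
      filter_upwards [hS.mem_nhds hzS] with y hy using hFG y hy
    rw [analyticOrderAt_congr h1, analyticOrderAt_mul (hG z hzS) (hu z hzS),
      ((hu z hzS).analyticOrderAt_eq_zero).2 (hu0 z hzS), add_zero]

theorem AnalyticOnNhd.exists_eq_exp {u : ℂ → ℂ} {r : ℝ} (hr : 0 < r)
    (hu : AnalyticOnNhd ℂ u (ball 0 r)) (hu0 : ∀ z ∈ ball 0 r, u z ≠ 0) :
    ∃ h : ℂ → ℂ, AnalyticOnNhd ℂ h (ball 0 r) ∧ ∀ z ∈ ball 0 r, u z = exp (h z) := by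
  have hd : DifferentiableOn ℂ (fun z => deriv u z / u z) (ball 0 r) := fun z hz =>
    ((hu z hz).deriv.div (hu z hz) (hu0 z hz)).differentiableAt.differentiableWithinAt
  have h0 : (0 : ℂ) ∈ ball (0 : ℂ) r := mem_ball_self hr
  obtain ⟨h, hh0, hh⟩ := hd.isExactOn_ball.with_val_at 0 (Complex.log (u 0))
  refine ⟨h, DifferentiableOn.analyticOnNhd
    (fun z hz => (hh z hz).differentiableAt.differentiableWithinAt) isOpen_ball, fun z hz => ?_⟩
  have hconst : ∀ z ∈ ball (0 : ℂ) r, HasDerivAt (fun z => u z * exp (-h z)) 0 z := by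
    intro z hz
    refine ((hu z hz).differentiableAt.hasDerivAt.mul (hh z hz).neg.cexp).congr_deriv ?_
    have := hu0 z hz
    field_simp
    simp
  have heq := isOpen_ball.is_const_of_deriv_eq_zero (convex_ball (0 : ℂ) r).isPreconnected
    (fun z hz => (hconst z hz).differentiableAt.differentiableWithinAt)
    (fun z hz => (hconst z hz).deriv) hz h0
  rw [hh0, exp_neg, exp_neg, Complex.exp_log (hu0 0 h0), mul_inv_cancel₀ (hu0 0 h0)] at heq
  exact (eq_of_mul_inv_eq_one heq)

theorem exists_lt_norm_of_norm_eq_one_on_sphere {b : ℂ → ℂ} (hb : ContinuousOn b (closedBall 0 1))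
    (hb1 : ∀ z ∈ sphere 0 1, ‖b z‖ = 1) {δ : ℝ} (hδ : δ < 1) :
    ∃ η : ℝ, η < 1 ∧ ∀ z ∈ ball (0 : ℂ) 1, η < ‖z‖ → δ < ‖b z‖ := by
  have hK : IsCompact (closedBall (0 : ℂ) 1 ∩ (fun z => ‖b z‖) ⁻¹' Iic δ) :=
    (isCompact_closedBall (0 : ℂ) 1).of_isClosed_subset
      (hb.norm.preimage_isClosed_of_isClosed isClosed_closedBall isClosed_Iic) inter_subset_left
  rcases (closedBall (0 : ℂ) 1 ∩ (fun z => ‖b z‖) ⁻¹' Iic δ).eq_empty_or_nonempty with he | hne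
  · refine ⟨0, one_pos, fun z hz _ => ?_⟩
    by_contra! hle
    exact (he ▸ ⟨ball_subset_closedBall hz, hle⟩ : z ∈ (∅ : Set ℂ))
  · obtain ⟨p, hp, hmax⟩ := hK.exists_isMaxOn hne continuous_norm.continuousOn
    refine ⟨‖p‖, ?_, fun z hz hpz => ?_⟩
    · refine (mem_closedBall_zero_iff.1 hp.1).lt_of_ne fun h1 => ?_
      have h2 : ‖b p‖ ≤ δ := hp.2
      rw [hb1 p (mem_sphere_zero_iff_norm.2 h1)] at h2
      exact h2.not_gt hδ
    · by_contra! hle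
      exact (hmax ⟨ball_subset_closedBall hz, hle⟩ : ‖z‖ ≤ ‖p‖).not_gt hpz

/-- The maximum principle on circles close to the boundary gives the bound `δ⁻¹`; then `δ` tends to
1. -/
theorem norm_le_one_of_norm_le_near_boundary {q : ℂ → ℂ} (hq : AnalyticOnNhd ℂ q (ball 0 1))
    (hlim : ∀ δ : ℝ, 0 < δ → δ < 1 →
      ∃ r : ℝ, r < 1 ∧ ∀ z ∈ ball (0 : ℂ) 1, r < ‖z‖ → ‖q z‖ ≤ δ⁻¹) :
    ∀ z ∈ ball (0 : ℂ) 1, ‖q z‖ ≤ 1 := by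
  intro z hz
  have hz1 := mem_ball_zero_iff.1 hz
  have key : ∀ δ ∈ Ioo (0 : ℝ) 1, ‖q z‖ ≤ δ⁻¹ := by
    rintro δ ⟨h0, h1⟩
    obtain ⟨r, hr, hqr⟩ := hlim δ h0 h1
    obtain ⟨ρ, hρ, hρ1⟩ := exists_between (max_lt hr hz1)
    have hsub : closedBall (0 : ℂ) ρ ⊆ ball 0 1 := closedBall_subset_ball hρ1
    refine Complex.norm_le_of_forall_mem_frontier_norm_le (U := ball 0 ρ) isBounded_ball
      (DifferentiableOn.diffContOnCl_ball (U := closedBall 0 ρ)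
        (fun x hx => (hq x (hsub hx)).differentiableAt.differentiableWithinAt) subset_rfl)
      (fun x hx => ?_) (subset_closure (mem_ball_zero_iff.2 ((le_max_right _ _).trans_lt hρ)))
    have hx' : x ∈ sphere (0 : ℂ) ρ := frontier_ball_subset_sphere hx
    refine hqr x (hsub (sphere_subset_closedBall hx')) ?_
    rw [mem_sphere_zero_iff_norm.1 hx']
    exact (le_max_left _ _).trans_lt hρ
  have hlim1 : Tendsto (fun δ : ℝ => δ⁻¹) (𝓝[<] 1) (𝓝 1) := by
    have : Tendsto (fun δ : ℝ => δ⁻¹) (𝓝 1) (𝓝 1⁻¹) := tendsto_inv₀ one_ne_zero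
    rw [inv_one] at this
    exact this.mono_left nhdsWithin_le_nhds
  refine ge_of_tendsto hlim1 ?_
  filter_upwards [Ioo_mem_nhdsLT (one_pos : (0 : ℝ) < 1)] with δ hδ using key δ hδ

theorem exists_eq_const_of_norm_tendsto_one {q : ℂ → ℂ} (hq : AnalyticOnNhd ℂ q (ball 0 1))
    (hq0 : ∀ z ∈ ball 0 1, q z ≠ 0)
    (hlim : ∀ δ : ℝ, 0 < δ → δ < 1 →
      ∃ r : ℝ, r < 1 ∧ ∀ z ∈ ball (0 : ℂ) 1, r < ‖z‖ → δ ≤ ‖q z‖ ∧ ‖q z‖ ≤ δ⁻¹) :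
    ∃ c : ℂ, ‖c‖ = 1 ∧ ∀ z ∈ ball 0 1, q z = c := by
  have h1 := norm_le_one_of_norm_le_near_boundary hq fun δ h0 h1 => by
    obtain ⟨r, hr, h⟩ := hlim δ h0 h1
    exact ⟨r, hr, fun z hz hzr => (h z hz hzr).2⟩
  have h2 := norm_le_one_of_norm_le_near_boundary (q := fun z => (q z)⁻¹)
    (fun z hz => (hq z hz).inv (hq0 z hz)) fun δ h0 h1 => by
      obtain ⟨r, hr, h⟩ := hlim δ h0 h1
      refine ⟨r, hr, fun z hz hzr => ?_⟩
      rw [norm_inv]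
      exact inv_anti₀ h0 (h z hz hzr).1
  have h3 : ∀ z ∈ ball (0 : ℂ) 1, ‖q z‖ = 1 := by
    intro z hz
    refine (h1 z hz).antisymm ?_
    have := h2 z hz
    rw [norm_inv] at this
    exact (inv_le_one₀ (norm_pos_iff.2 (hq0 z hz))).1 this
  have h0 : (0 : ℂ) ∈ ball (0 : ℂ) 1 := mem_ball_self one_pos
  refine ⟨q 0, h3 0 h0, fun z hz => ?_⟩
  refine Complex.eq_const_of_exists_max hq.differentiableOn h0 (fun x hx => ?_) hz
  simp [h3 x hx, h3 0 h0]

/-! ### Finite Blaschke products. -/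

/-- The finite Blaschke product with zeros `a ∈ Z` of multiplicity `m a`. -/
noncomputable def blaschkeProduct (Z : Finset ℂ) (m : ℂ → ℕ) (z : ℂ) : ℂ :=
  ∏ a ∈ Z, ((z - a) / (1 - (starRingEnd ℂ) a * z)) ^ m a

theorem one_sub_conj_mul_ne_zero {a z : ℂ} (ha : ‖a‖ < 1) (hz : ‖z‖ ≤ 1) :
    1 - (starRingEnd ℂ) a * z ≠ 0 := by
  intro h
  have h1 : ‖(starRingEnd ℂ) a * z‖ = 1 := by rw [← sub_eq_zero.1 h, norm_one]
  rw [norm_mul, RCLike.norm_conj] at h1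
  have := mul_le_of_le_one_right (norm_nonneg a) hz
  linarith

theorem norm_sub_eq_norm_one_sub_conj_mul {a z : ℂ} (hz : ‖z‖ = 1) :
    ‖z - a‖ = ‖1 - (starRingEnd ℂ) a * z‖ := by
  have h1 : z * (starRingEnd ℂ) z = 1 := by rw [mul_conj, normSq_eq_norm_sq, hz]; simp
  have h2 : 1 - (starRingEnd ℂ) a * z = z * (starRingEnd ℂ) (z - a) := by
    rw [map_sub, mul_sub, h1]; ring
  rw [h2, norm_mul, hz, one_mul, RCLike.norm_conj]

/-- The value is the Poisson kernel. Its positivity is what places `z * b' / b` in the slit plane.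
-/
theorem mul_logDeriv_blaschkeFactor {a z : ℂ} (ha : ‖a‖ < 1) (hz : ‖z‖ = 1) :
    z * logDeriv (fun z => (z - a) / (1 - (starRingEnd ℂ) a * z)) z =
      (((1 - ‖a‖ ^ 2) / ‖z - a‖ ^ 2 : ℝ) : ℂ) := by
  have hden := one_sub_conj_mul_ne_zero ha hz.le
  have hza : z - a ≠ 0 := fun h => by
    rw [sub_eq_zero.1 h] at hz
    exact ha.ne hz
  have h1 : z * (starRingEnd ℂ) z = 1 := by rw [mul_conj, normSq_eq_norm_sq, hz]; simp
  have h2 : 1 - (starRingEnd ℂ) a * z = z * (starRingEnd ℂ) (z - a) := by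
    rw [map_sub, mul_sub, h1]; ring
  have hz0 : z ≠ 0 := fun h => by simp [h] at hz
  have hc : (starRingEnd ℂ) (z - a) ≠ 0 := (map_ne_zero _).2 hza
  have hd : deriv (fun z => 1 - (starRingEnd ℂ) a * z) z = - (starRingEnd ℂ) a := by
    simp [deriv_const_sub]
  rw [logDeriv_div z hza hden (by fun_prop) (by fun_prop), logDeriv_apply, logDeriv_apply, hd, h2]
  push_cast
  rw [← mul_conj' a, ← mul_conj' (z - a)]
  simp only [deriv_sub_const_fun, deriv_id'']
  field_simp
  rw [map_sub]
  linear_combination h1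

section

variable {Z : Finset ℂ} {m : ℂ → ℕ}

theorem analyticOnNhd_blaschkeProduct (hZ : ∀ a ∈ Z, ‖a‖ < 1) :
    AnalyticOnNhd ℂ (blaschkeProduct Z m) (closedBall 0 1) := by
  intro z hz
  refine Finset.analyticAt_fun_prod Z fun a ha => ?_
  have h1 : AnalyticAt ℂ (fun z => z - a) z := by fun_prop
  have h2 : AnalyticAt ℂ (fun z => 1 - (starRingEnd ℂ) a * z) z := by fun_prop
  exact (h1.div h2 (one_sub_conj_mul_ne_zero (hZ a ha) (mem_closedBall_zero_iff.1 hz))).pow _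

theorem norm_blaschkeProduct_eq_one (hZ : ∀ a ∈ Z, ‖a‖ < 1) {z : ℂ} (hz : ‖z‖ = 1) :
    ‖blaschkeProduct Z m z‖ = 1 := by
  rw [blaschkeProduct, norm_prod]
  refine Finset.prod_eq_one fun a ha => ?_
  rw [norm_pow, norm_div, norm_sub_eq_norm_one_sub_conj_mul hz, div_self, one_pow]
  exact norm_ne_zero_iff.2 (one_sub_conj_mul_ne_zero (hZ a ha) hz.le)

theorem mul_logDeriv_blaschkeProduct (hZ : ∀ a ∈ Z, ‖a‖ < 1) {z : ℂ} (hz : ‖z‖ = 1) :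
    z * logDeriv (blaschkeProduct Z m) z =
      ((∑ a ∈ Z, m a * ((1 - ‖a‖ ^ 2) / ‖z - a‖ ^ 2) : ℝ) : ℂ) := by
  have hden : ∀ a ∈ Z, 1 - (starRingEnd ℂ) a * z ≠ 0 := fun a ha =>
    one_sub_conj_mul_ne_zero (hZ a ha) hz.le
  have hne : ∀ a ∈ Z, (z - a) / (1 - (starRingEnd ℂ) a * z) ≠ 0 := fun a ha =>
    div_ne_zero (fun h => (hZ a ha).ne (by rw [← sub_eq_zero.1 h, hz])) (hden a ha)
  have hdiff : ∀ a ∈ Z, DifferentiableAt ℂ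
      (fun z => (z - a) / (1 - (starRingEnd ℂ) a * z)) z := fun a ha =>
    DifferentiableAt.div (by fun_prop) (by fun_prop) (hden a ha)
  have h1 := logDeriv_prod (s := Z)
    (f := fun a z => ((z - a) / (1 - (starRingEnd ℂ) a * z)) ^ m a) (x := z)
    (fun a ha => pow_ne_zero _ (hne a ha)) (fun a ha => (hdiff a ha).pow _)
  have h2 : logDeriv (blaschkeProduct Z m) z = _ := h1
  rw [h2, Finset.mul_sum]
  push_cast
  refine Finset.sum_congr rfl fun a ha => ?_
  rw [logDeriv_fun_pow (hdiff a ha), mul_left_comm, mul_logDeriv_blaschkeFactor (hZ a ha) hz]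
  push_cast
  rfl

theorem mul_logDeriv_blaschkeProduct_mem_slitPlane (hZ : ∀ a ∈ Z, ‖a‖ < 1)
    (hm : 0 < ∑ a ∈ Z, m a) {z : ℂ} (hz : ‖z‖ = 1) :
    z * logDeriv (blaschkeProduct Z m) z ∈ slitPlane := by
  rw [mul_logDeriv_blaschkeProduct hZ hz, ofReal_mem_slitPlane]
  have hpos : ∀ a ∈ Z, 0 < (1 - ‖a‖ ^ 2) / ‖z - a‖ ^ 2 := by
    intro a ha
    have h1 := hZ a ha
    have h2 : z - a ≠ 0 := fun h => h1.ne (by rw [← sub_eq_zero.1 h, hz])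
    have h3 := norm_pos_iff.2 h2
    have h4 : 0 < 1 - ‖a‖ ^ 2 := by nlinarith [norm_nonneg a]
    positivity
  obtain ⟨a, ha, hma⟩ := Finset.exists_ne_zero_of_sum_ne_zero hm.ne'
  exact Finset.sum_pos' (fun a ha => mul_nonneg (Nat.cast_nonneg _) (hpos a ha).le)
    ⟨a, ha, mul_pos (Nat.cast_pos.2 (Nat.pos_of_ne_zero hma)) (hpos a ha)⟩

/-- Rouché compares `z * b'` with `b`. The factor `z` contributes one zero, so `1 + k = n` and the
subtraction `n - 1` is not truncated. -/
theorem HasExactlyZeros.deriv_blaschkeProduct {n : ℕ} (hZ : ∀ a ∈ Z, ‖a‖ < 1)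
    (hm : 0 < ∑ a ∈ Z, m a) (hn : HasExactlyZeros (blaschkeProduct Z m) (ball 0 1) n) :
    HasExactlyZeros (deriv (blaschkeProduct Z m)) (ball 0 1) (n - 1) := by
  have hb := analyticOnNhd_blaschkeProduct (m := m) hZ
  have hb' := hb.deriv
  have hmem : ∀ z ∈ sphere (0 : ℂ) 1,
      z * deriv (blaschkeProduct Z m) z / blaschkeProduct Z m z ∈ slitPlane := by
    intro z hz
    rw [mul_div_assoc]
    exact mul_logDeriv_blaschkeProduct_mem_slitPlane hZ hm (mem_sphere_zero_iff_norm.1 hz)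
  obtain ⟨k, hk⟩ := exists_hasExactlyZeros_ball one_pos hb' fun z hz h0 => by
    have := hmem z hz
    simp [h0] at this
  have hid : HasExactlyZeros (fun z => z) (ball 0 1) 1 := by
    refine ⟨{0}, fun z => ?_, ?_⟩
    · rw [Finset.mem_singleton]
      exact ⟨fun h => ⟨h ▸ mem_ball_self one_pos, h⟩, fun h => h.2⟩
    · have := analyticOrderAt_id_sub_const_self (𝕜 := ℂ) (c := 0)
      simpa using this
  have h1 := hid.mul (fun _ _ => analyticAt_id)
    (fun z hz => hb' z (ball_subset_closedBall hz)) hk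
  have h2 := h1.eq_of_div_mem_slitPlane one_pos
    (fun z hz => analyticAt_id.mul (hb' z hz)) hb hn hmem
  rwa [← h2, Nat.add_sub_cancel_left]

end

section

variable {b : ℂ → ℂ} {n : ℕ}

theorem norm_lt_one_of_norm_eq_one_on_sphere (hb : AnalyticOnNhd ℂ b (closedBall 0 1))
    (hb1 : ∀ z ∈ sphere 0 1, ‖b z‖ = 1) {z₀ : ℂ} (hz₀ : z₀ ∈ ball 0 1) (hbz₀ : b z₀ = 0) :
    ∀ z ∈ ball 0 1, ‖b z‖ < 1 := by
  have hle : ∀ z ∈ closedBall (0 : ℂ) 1, ‖b z‖ ≤ 1 := by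
    intro z hz
    refine Complex.norm_le_of_forall_mem_frontier_norm_le (U := ball 0 1) isBounded_ball
      (hb.differentiableOn.diffContOnCl_ball subset_rfl)
      (fun x hx => (hb1 x (frontier_ball_subset_sphere hx)).le) ?_
    rwa [closure_ball 0 one_ne_zero]
  intro z hz
  refine (hle z (ball_subset_closedBall hz)).lt_of_ne fun h1 => ?_
  have := Complex.eq_const_of_exists_max
    (hb.differentiableOn.mono ball_subset_closedBall) hz
    (fun x hx => by simpa [h1] using hle x (ball_subset_closedBall hx)) hz₀
  rw [hbz₀, Function.const_apply] at this
  rw [← this] at h1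
  simp at h1

/-- Rouché against `b`, since `|v| < 1 = |b|` on the circle. -/
theorem HasExactlyZeros.sub_const_of_norm_lt_one (hb : AnalyticOnNhd ℂ b (closedBall 0 1))
    (hb1 : ∀ z ∈ sphere 0 1, ‖b z‖ = 1) (hn : HasExactlyZeros b (ball 0 1) n) {v : ℂ}
    (hv : ‖v‖ < 1) : HasExactlyZeros (fun z => b z - v) (ball 0 1) n := by
  have hb' : AnalyticOnNhd ℂ (fun z => b z - v) (closedBall 0 1) := fun z hz =>
    (hb z hz).sub analyticAt_const
  obtain ⟨k, hk⟩ := exists_hasExactlyZeros_ball one_pos hb' fun z hz h0 => by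
    have := hb1 z hz
    rw [sub_eq_zero.1 h0] at this
    exact hv.ne this
  have := hk.eq_of_div_mem_slitPlane one_pos hb' hb hn fun z hz => by
    have h0 : b z ≠ 0 := norm_pos_iff.1 (by rw [hb1 z hz]; exact one_pos)
    have h1 : (b z - v) / b z = 1 + -(v / b z) := by field_simp; ring
    rw [h1]
    refine mem_slitPlane_of_norm_lt_one ?_
    rwa [norm_neg, norm_div, hb1 z hz, div_one]
  rwa [this] at hk

end

/-! ### Factorization of the Blaschke product through `f`. -/

section

variable {n : ℕ} {f : ℂ → ℂ}

theorem IsExactlyNToOneOn.exists_comp_eq_blaschkeProduct (hn : 1 ≤ n)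
    (hf : AnalyticOnNhd ℂ f (ball 0 1)) (hfn : IsExactlyNToOneOn f (ball 0 1) n) :
    ∃ (Z : Finset ℂ) (m : ℂ → ℕ) (φ : ℂ → ℂ) (c : ℂ), (∀ a ∈ Z, ‖a‖ < 1) ∧ 0 < ∑ a ∈ Z, m a ∧
      AnalyticOnNhd ℂ φ (f '' ball 0 1) ∧ ‖c‖ = 1 ∧
      HasExactlyZeros (blaschkeProduct Z m) (ball 0 1) n ∧
      ∀ z ∈ ball 0 1, φ (f z) = c * blaschkeProduct Z m z := by
  have h0 : (0 : ℂ) ∈ ball (0 : ℂ) 1 := mem_ball_self one_pos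
  set w₀ := f 0
  have hn0 : (n : ℂ) ≠ 0 := Nat.cast_ne_zero.2 (by omega)
  have hfw : AnalyticOnNhd ℂ (fun z => f z - w₀) (ball 0 1) := fun z hz =>
    (hf z hz).sub analyticAt_const
  have hkn : HasExactlyZeros (fun z => f z - w₀) (ball 0 1) n := hfn w₀ ⟨0, h0, rfl⟩
  obtain ⟨Z, hZ, hsum⟩ := hkn
  have hZ1 : ∀ a ∈ Z, ‖a‖ < 1 := fun a ha => mem_ball_zero_iff.1 ((hZ a).1 ha).1
  set m : ℂ → ℕ := analyticOrderNatAt fun z => f z - w₀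
  obtain ⟨g, hg, hgZ, hfg⟩ := hfw.exists_eq_prod_mul Z (fun a ha => ((hZ a).1 ha).1)
    (analyticOrderAt_ne_top_of_sum_eq hsum)
  set b := blaschkeProduct Z m with hbdef
  have hden : ∀ z ∈ ball (0 : ℂ) 1, ∀ a ∈ Z, 1 - (starRingEnd ℂ) a * z ≠ 0 := fun z hz a ha =>
    one_sub_conj_mul_ne_zero (hZ1 a ha) (mem_ball_zero_iff.1 hz).le
  set u : ℂ → ℂ := fun z => (∏ a ∈ Z, (1 - (starRingEnd ℂ) a * z) ^ m a) * g z with hudef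
  have hu : AnalyticOnNhd ℂ u (ball 0 1) := fun z hz => by
    have h1 : AnalyticAt ℂ (fun z => ∏ a ∈ Z, (1 - (starRingEnd ℂ) a * z) ^ m a) z := by fun_prop
    exact h1.mul (hg z hz)
  have hg0 : ∀ z ∈ ball (0 : ℂ) 1, g z ≠ 0 := fun z hz hgz =>
    hgZ z ((hZ z).2 ⟨hz, (hfg z).trans (by rw [hgz, mul_zero])⟩) hgz
  have hu0 : ∀ z ∈ ball (0 : ℂ) 1, u z ≠ 0 := fun z hz =>
    mul_ne_zero (Finset.prod_ne_zero_iff.2 fun a ha => pow_ne_zero _ (hden z hz a ha)) (hg0 z hz)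
  have hbu : ∀ z ∈ ball (0 : ℂ) 1, f z - w₀ = b z * u z := by
    intro z hz
    rw [hfg z, hbdef, blaschkeProduct, hudef, ← mul_assoc, ← Finset.prod_mul_distrib]
    congr 1
    refine Finset.prod_congr rfl fun a ha => ?_
    rw [← mul_pow, div_mul_cancel₀ _ (hden z hz a ha)]
  have hb : AnalyticOnNhd ℂ b (closedBall 0 1) := analyticOnNhd_blaschkeProduct hZ1
  have hb1 : ∀ z ∈ sphere (0 : ℂ) 1, ‖b z‖ = 1 := fun z hz =>
    norm_blaschkeProduct_eq_one hZ1 (mem_sphere_zero_iff_norm.1 hz)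
  have hbn : HasExactlyZeros b (ball 0 1) n := HasExactlyZeros.of_eqOn_mul isOpen_ball
    (hb.mono ball_subset_closedBall) hu hu0 hbu ⟨Z, hZ, hsum⟩
  have hblt : ∀ z ∈ ball (0 : ℂ) 1, ‖b z‖ < 1 := by
    refine norm_lt_one_of_norm_eq_one_on_sphere hb hb1 h0 ?_
    have := hbu 0 h0
    rw [sub_self, eq_comm, mul_eq_zero] at this
    exact this.resolve_right (hu0 0 h0)
  obtain ⟨h, hh, huh⟩ := hu.exists_eq_exp one_pos hu0
  set H := fiberSum f h (ball 0 1)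
  have hH : AnalyticOnNhd ℂ H (f '' ball 0 1) := hfn.analyticOnNhd_fiberSum hf hh
  -- `H / n` averages `h` over the fibre, a substitute for `h` that is a function of `w` alone.
  set φ : ℂ → ℂ := fun w => (w - w₀) * exp (-(H w / n)) with hφdef
  have hφ : AnalyticOnNhd ℂ φ (f '' ball 0 1) := fun w hw =>
    (analyticAt_id.sub analyticAt_const).mul
      ((hH w hw).div analyticAt_const hn0).neg.cexp
  set q : ℂ → ℂ := fun z => exp (h z - H (f z) / n) with hqdef
  have hq : AnalyticOnNhd ℂ q (ball 0 1) := fun z hz =>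
    ((hh z hz).sub (((hH (f z) ⟨z, hz, rfl⟩).comp (hf z hz)).div analyticAt_const hn0)).cexp
  have hφq : ∀ z ∈ ball (0 : ℂ) 1, φ (f z) = b z * q z := by
    intro z hz
    simp only [hφdef, hqdef]
    rw [hbu z hz, huh z hz, mul_assoc, ← exp_add, sub_eq_add_neg]
  have hpow : ∀ w ∈ f '' ball 0 1, ∃ Y : Finset ℂ, ∃ k : ℂ → ℕ,
      (∀ y ∈ Y, y ∈ ball (0 : ℂ) 1 ∧ f y = w) ∧ ∑ y ∈ Y, k y = n ∧
      φ w ^ n = ∏ y ∈ Y, b y ^ k y := by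
    intro w hw
    obtain ⟨Y, hY, hYsum⟩ := hfn w hw
    have hYn := sum_analyticOrderNatAt_eq hYsum
    have hY' : ∀ y ∈ Y, y ∈ ball (0 : ℂ) 1 ∧ f y = w := fun y hy =>
      ⟨((hY y).1 hy).1, sub_eq_zero.1 ((hY y).1 hy).2⟩
    refine ⟨Y, analyticOrderNatAt fun z => f z - w, hY', hYn, ?_⟩
    -- Multiply `w - w₀ = b y * exp (h y)` over the `n` points `y` of the fibre.
    have h1 : (w - w₀) ^ n =
        (∏ y ∈ Y, b y ^ analyticOrderNatAt (fun z => f z - w) y) * exp (H w) := by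
      rw [show H w = _ from fiberSum_eq_sum hY, exp_sum, ← Finset.prod_mul_distrib, ← hYn,
        ← Finset.prod_pow_eq_pow_sum]
      refine Finset.prod_congr rfl fun y hy => ?_
      rw [exp_nat_mul, ← huh y (hY' y hy).1, ← mul_pow, ← hbu y (hY' y hy).1, (hY' y hy).2]
    rw [hφdef, mul_pow, h1, ← exp_nat_mul, mul_assoc, ← exp_add]
    have : H w + n * -(H w / n) = 0 := by field_simp; ring
    rw [this, exp_zero, mul_one]
  have hlim : ∀ δ : ℝ, 0 < δ → δ < 1 →
      ∃ r : ℝ, r < 1 ∧ ∀ z ∈ ball (0 : ℂ) 1, r < ‖z‖ → δ ≤ ‖q z‖ ∧ ‖q z‖ ≤ δ⁻¹ := by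
    intro δ hδ0 hδ1
    obtain ⟨η, hη, hbη⟩ := exists_lt_norm_of_norm_eq_one_on_sphere hb.continuousOn hb1 hδ1
    obtain ⟨r, hr, hfr⟩ := hfn.exists_norm_lt_of_norm_lt hf hη
    refine ⟨r, hr, fun z hz hzr => ?_⟩
    obtain ⟨Y, k, hY, hk, hprod⟩ := hpow (f z) ⟨z, hz, rfl⟩
    -- With `z` near the boundary its whole fibre lies where `|b| > δ`, so `δ ≤ |φ (f z)| ≤ 1`;
    -- dividing by `|b z|`, which is between `δ` and 1, bounds `|q z|`.
    have hbz := hbη z hz (hfr z hz z hz hzr rfl)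
    have hbz1 := hblt z hz
    have hnφ : ‖φ (f z)‖ ^ n = ∏ y ∈ Y, ‖b y‖ ^ k y := by
      rw [← norm_pow, hprod, norm_prod]
      simp only [norm_pow]
    have hφ1 : ‖φ (f z)‖ ≤ 1 := by
      refine (pow_le_one_iff_of_nonneg (norm_nonneg _) (by omega : n ≠ 0)).1 ?_
      rw [hnφ]
      exact Finset.prod_le_one (fun y _ => by positivity) fun y hy =>
        pow_le_one₀ (norm_nonneg _) (hblt y (hY y hy).1).le
    have hφδ : δ ≤ ‖φ (f z)‖ := by
      refine (pow_le_pow_iff_left₀ hδ0.le (norm_nonneg _) (by omega : n ≠ 0)).1 ?_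
      rw [hnφ, ← hk, ← Finset.prod_pow_eq_pow_sum]
      refine Finset.prod_le_prod (fun y _ => by positivity) fun y hy => ?_
      exact pow_le_pow_left₀ hδ0.le
        (hbη y (hY y hy).1 (hfr z hz y (hY y hy).1 hzr (hY y hy).2)).le _
    rw [hφq z hz, norm_mul] at hφ1 hφδ
    constructor
    · exact hφδ.trans (mul_le_of_le_one_left (norm_nonneg _) hbz1.le)
    · rw [← one_div, le_div_iff₀ hδ0, mul_comm]
      exact (mul_le_mul_of_nonneg_right hbz.le (norm_nonneg _)).trans hφ1
  obtain ⟨c, hc, hqc⟩ := exists_eq_const_of_norm_tendsto_one hq (fun z _ => exp_ne_zero _) hlim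
  refine ⟨Z, m, φ, c, hZ1, ?_, hφ, hc, hbn, fun z hz => ?_⟩
  · rw [sum_analyticOrderNatAt_eq hsum]
    omega
  · rw [hφq z hz, hqc z hz, mul_comm]

/-- Orders multiply under composition, so the fibre of `f` above `w` supplies `n` zeros of `b - v`
for each unit of the order of `φ - φ w` at `w`. -/
theorem sum_analyticOrderAt_fiber_comp (hf : AnalyticOnNhd ℂ f (ball 0 1))
    (hfn : IsExactlyNToOneOn f (ball 0 1) n) {φ b : ℂ → ℂ} {c : ℂ} (hc : c ≠ 0)
    (hb : AnalyticOnNhd ℂ b (ball 0 1)) (hφ : AnalyticOnNhd ℂ φ (f '' ball 0 1))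
    (hφb : ∀ z ∈ ball 0 1, φ (f z) = c * b z) {w v : ℂ} (hw : w ∈ f '' ball 0 1)
    (hwv : φ w = c * v) :
    ∃ Y : Finset ℂ, (∀ y, y ∈ Y ↔ y ∈ ball (0 : ℂ) 1 ∧ f y = w) ∧ (∀ y ∈ Y, b y - v = 0) ∧
      ∑ y ∈ Y, analyticOrderAt (fun z => b z - v) y =
        analyticOrderAt (fun x => φ x - φ w) w * n := by
  obtain ⟨Y, hY, hYsum⟩ := hfn w hw
  have hY' : ∀ y, y ∈ Y ↔ y ∈ ball (0 : ℂ) 1 ∧ f y = w := fun y => by rw [hY, sub_eq_zero]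
  refine ⟨Y, hY', fun y hy => ?_, ?_⟩
  · obtain ⟨hy1, hyw⟩ := (hY' y).1 hy
    have := hφb y hy1
    rw [hyw, hwv] at this
    rw [mul_left_cancel₀ hc this, sub_self]
  · rw [← hYsum, Finset.mul_sum]
    refine Finset.sum_congr rfl fun y hy => ?_
    obtain ⟨hy1, rfl⟩ := (hY' y).1 hy
    have hφy : AnalyticAt ℂ (fun x => φ x - φ (f y)) (f y) := (hφ _ hw).sub analyticAt_const
    rw [← hφy.analyticOrderAt_comp (hf y hy1)]
    have h1 : ((fun x => φ x - φ (f y)) ∘ f) =ᶠ[𝓝 y] (fun _ => c) * fun z => b z - v := by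
      filter_upwards [isOpen_ball.mem_nhds hy1] with z hz
      simp only [Function.comp_apply, Pi.mul_apply, hφb z hz, hwv]
      ring
    have hbv : AnalyticAt ℂ (fun z => b z - v) y := (hb y hy1).sub analyticAt_const
    rw [analyticOrderAt_congr h1, analyticOrderAt_mul analyticAt_const hbv, (analyticAt_const.analyticOrderAt_eq_zero).2 hc, zero_add]

/-- Two fibres of `f` with the same `φ`-value would give `b` that value at least `2 * n` times. -/
theorem injOn_of_comp_eq (hn : 1 ≤ n) (hf : AnalyticOnNhd ℂ f (ball 0 1))
    (hfn : IsExactlyNToOneOn f (ball 0 1) n) {φ b : ℂ → ℂ} {c : ℂ} (hc : c ≠ 0)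
    (hb : AnalyticOnNhd ℂ b (ball 0 1)) (hφ : AnalyticOnNhd ℂ φ (f '' ball 0 1))
    (hbn : ∀ z ∈ ball 0 1, HasExactlyZeros (fun x => b x - b z) (ball 0 1) n)
    (hφb : ∀ z ∈ ball 0 1, φ (f z) = c * b z) : InjOn φ (f '' ball 0 1) := by
  classical
  rintro w hw w' hw' hww
  by_contra hne
  obtain ⟨z, hz, hzw⟩ := id hw
  have h1 : φ w = c * b z := by rw [← hzw, hφb z hz]
  obtain ⟨X, hX, hXsum⟩ := hbn z hz
  obtain ⟨Y, hY, hYb, hYsum⟩ := sum_analyticOrderAt_fiber_comp hf hfn hc hb hφ hφb hw h1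
  obtain ⟨Y', hY', hYb', hYsum'⟩ :=
    sum_analyticOrderAt_fiber_comp hf hfn hc hb hφ hφb hw' (hww ▸ h1)
  have hdisj : Disjoint Y Y' := Finset.disjoint_left.2 fun y hy hy' =>
    hne (((hY y).1 hy).2.symm.trans ((hY' y).1 hy').2)
  have hsub : Y ∪ Y' ⊆ X := by
    refine Finset.union_subset (fun y hy => ?_) (fun y hy => ?_)
    · exact (hX y).2 ⟨((hY y).1 hy).1, hYb y hy⟩
    · exact (hX y).2 ⟨((hY' y).1 hy).1, hYb' y hy⟩
  have hge : ∀ x ∈ f '' ball 0 1, (n : ℕ∞) ≤ analyticOrderAt (fun y => φ y - φ x) x * n := by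
    intro x hx
    have h2 : analyticOrderAt (fun y => φ y - φ x) x ≠ 0 :=
      analyticOrderAt_ne_zero.2 ⟨(hφ x hx).sub analyticAt_const, sub_self _⟩
    exact le_mul_of_one_le_left zero_le (Order.one_le_iff_ne_zero.2 h2)
  have hle : ((n + n : ℕ) : ℕ∞) ≤ n := by
    push_cast
    refine (add_le_add (hge w hw) (hge w' hw')).trans ?_
    rw [← hYsum, ← hYsum', ← Finset.sum_union hdisj, ← hXsum]
    exact Finset.sum_le_sum_of_subset hsub
  have : n + n ≤ n := by exact_mod_cast hle
  omega

/-- At a critical point `φ - φ w` has order at least 2, which again yields `2 * n` zeros from one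
fibre. -/
theorem deriv_ne_zero_of_comp_eq (hn : 1 ≤ n) (hf : AnalyticOnNhd ℂ f (ball 0 1))
    (hfn : IsExactlyNToOneOn f (ball 0 1) n) {φ b : ℂ → ℂ} {c : ℂ} (hc : c ≠ 0)
    (hb : AnalyticOnNhd ℂ b (ball 0 1)) (hφ : AnalyticOnNhd ℂ φ (f '' ball 0 1))
    (hbn : ∀ z ∈ ball 0 1, HasExactlyZeros (fun x => b x - b z) (ball 0 1) n)
    (hφb : ∀ z ∈ ball 0 1, φ (f z) = c * b z) : ∀ w ∈ f '' ball 0 1, deriv φ w ≠ 0 := by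
  rintro w hw hd
  obtain ⟨z, hz, hzw⟩ := id hw
  have h1 : φ w = c * b z := by rw [← hzw, hφb z hz]
  obtain ⟨X, hX, hXsum⟩ := hbn z hz
  obtain ⟨Y, hY, hYb, hYsum⟩ := sum_analyticOrderAt_fiber_comp hf hfn hc hb hφ hφb hw h1
  have hsub : Y ⊆ X := fun y hy => (hX y).2 ⟨((hY y).1 hy).1, hYb y hy⟩
  have h2 : analyticOrderAt (fun x => φ x - φ w) w * n ≤ n := by
    rw [← hYsum]
    exact (Finset.sum_le_sum_of_subset hsub).trans_eq hXsum
  have h3 : 1 ≤ analyticOrderAt (deriv φ) w :=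
    Order.one_le_iff_ne_zero.2 (analyticOrderAt_ne_zero.2 ⟨(hφ w hw).deriv, hd⟩)
  rw [← (hφ w hw).analyticOrderAt_deriv_add_one] at h2
  have h4 : ((2 * n : ℕ) : ℕ∞) ≤ n := by
    push_cast
    refine le_trans (mul_le_mul_left ?_ _) h2
    rw [← one_add_one_eq_two]
    exact add_le_add_left h3 1
  have : 2 * n ≤ n := by exact_mod_cast h4
  omega

/-! ### Topology of the image and conclusion. -/

theorem isSimplyConnected_of_injOn_of_image_eq_ball {U : Set ℂ} {φ : ℂ → ℂ} (hU : IsOpen U)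
    (hUc : IsPreconnected U) (hφ : AnalyticOnNhd ℂ φ U) (hinj : InjOn φ U)
    (himg : φ '' U = ball 0 1) : IsSimplyConnected U := by
  have hopen : ∀ s ⊆ U, IsOpen s → IsOpen (φ '' s) := by
    refine (hφ.is_constant_or_isOpen hUc).resolve_left ?_
    rintro ⟨w, hw⟩
    have hsub : (ball (0 : ℂ) 1).Subsingleton := by
      rw [← himg]
      rintro _ ⟨x, hx, rfl⟩ _ ⟨y, hy, rfl⟩
      rw [hw x hx, hw y hy]
    have h0 : (0 : ℂ) ∈ ball (0 : ℂ) 1 := mem_ball_self one_pos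
    have h1 : (1 / 2 : ℂ) ∈ ball (0 : ℂ) 1 := by
      rw [mem_ball_zero_iff]; norm_num
    have := hsub h0 h1
    norm_num at this
  -- By the open mapping theorem `φ` is a homeomorphism from `U` onto the disc, so simple
  -- connectivity transfers back.
  have hemb : IsOpenEmbedding (U.domRestrict φ) := by
    refine .of_continuous_injective_isOpenMap hφ.continuousOn.domRestrict hinj.injective ?_
    intro s hs
    have h1 : U.domRestrict φ '' s = φ '' (Subtype.val '' s) := by
      rw [image_image]; rfl
    rw [h1]
    exact hopen _ (Subtype.coe_image_subset U s) (hU.isOpenMap_subtype_val s hs)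
  have hball : IsSimplyConnected (ball (0 : ℂ) 1) := by
    have : ContractibleSpace (ball (0 : ℂ) 1) :=
      (convex_ball 0 1).contractibleSpace ⟨0, mem_ball_self one_pos⟩
    exact SimplyConnectedSpace.ofContractible _
  rw [← himg, ← range_domRestrict, ← image_univ, hemb.isEmbedding.isSimplyConnected_image] at hball
  exact (Homeomorph.Set.univ U).toHomotopyEquiv.simplyConnectedSpace_iff.1 hball

end

theorem mainTheorem4 (n : ℕ) (hn : 1 ≤ n) (f : ℂ → ℂ)
    (hf : AnalyticOnNhd ℂ f (Metric.ball 0 1))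
    (hfn : IsExactlyNToOneOn f (Metric.ball 0 1) n) :
    IsSimplyConnected (f '' Metric.ball 0 1) ∧
      HasExactlyZeros (deriv f) (Metric.ball 0 1) (n - 1) := by
  obtain ⟨Z, m, φ, c, hZ, hm, hφ, hc, hbn, hφb⟩ := hfn.exists_comp_eq_blaschkeProduct hn hf
  have hc0 : c ≠ 0 := norm_pos_iff.1 (hc ▸ one_pos)
  have hbc := analyticOnNhd_blaschkeProduct (m := m) hZ
  have hder := hbn.deriv_blaschkeProduct hZ hm
  have hb1 : ∀ z ∈ sphere (0 : ℂ) 1, ‖blaschkeProduct Z m z‖ = 1 := fun z hz =>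
    norm_blaschkeProduct_eq_one hZ (mem_sphere_zero_iff_norm.1 hz)
  generalize blaschkeProduct Z m = b at *
  have hb : AnalyticOnNhd ℂ b (ball 0 1) := hbc.mono ball_subset_closedBall
  have hbv : ∀ v : ℂ, ‖v‖ < 1 → HasExactlyZeros (fun x => b x - v) (ball 0 1) n := fun v hv =>
    hbn.sub_const_of_norm_lt_one hbc hb1 hv
  have hsurj : ∀ v : ℂ, ‖v‖ < 1 → ∃ z ∈ ball (0 : ℂ) 1, b z = v := by
    intro v hv
    obtain ⟨X, hX, hXsum⟩ := hbv v hv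
    have : X.Nonempty := by
      rw [Finset.nonempty_iff_ne_empty]
      rintro rfl
      rw [Finset.sum_empty] at hXsum
      have : 0 = n := by exact_mod_cast hXsum
      omega
    obtain ⟨x, hx⟩ := this
    exact ⟨x, ((hX x).1 hx).1, sub_eq_zero.1 ((hX x).1 hx).2⟩
  obtain ⟨z₀, hz₀, hbz₀⟩ := hsurj 0 (by simp)
  have hblt := norm_lt_one_of_norm_eq_one_on_sphere hbc hb1 hz₀ hbz₀
  have hbz := fun z hz => hbv (b z) (hblt z hz)
  have hd := deriv_ne_zero_of_comp_eq hn hf hfn hc0 hb hφ hbz hφb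
  refine ⟨isSimplyConnected_of_injOn_of_image_eq_ball (hfn.isOpen_image hf)
    ((convex_ball 0 1).isPreconnected.image f hf.continuousOn) hφ
    (injOn_of_comp_eq hn hf hfn hc0 hb hφ hbz hφb) ?_, ?_⟩
  · ext v
    rw [image_image]
    constructor
    · rintro ⟨z, hz, rfl⟩
      beta_reduce
      rw [mem_ball_zero_iff, hφb z hz, norm_mul, hc, one_mul]
      exact hblt z hz
    · intro hv
      obtain ⟨z, hz, hzv⟩ := hsurj (c⁻¹ * v) (by
        rw [norm_mul, norm_inv, hc, inv_one, one_mul]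
        exact mem_ball_zero_iff.1 hv)
      exact ⟨z, hz, (hφb z hz).trans (by rw [hzv, mul_inv_cancel_left₀ hc0])⟩
  -- The chain rule for `φ ∘ f = c * b` shows that `b'` is `f'` times this zero-free factor.
  · refine hder.of_eqOn_mul (u := fun z => c⁻¹ * deriv φ (f z)) isOpen_ball hf.deriv
      (fun z hz => ?_) (fun z hz => ?_) (fun z hz => ?_)
    · exact analyticAt_const.mul ((hφ (f z) ⟨z, hz, rfl⟩).deriv.comp (hf z hz))
    · exact mul_ne_zero (inv_ne_zero hc0) (hd (f z) ⟨z, hz, rfl⟩)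
    · have h1 : φ ∘ f =ᶠ[𝓝 z] fun z => c * b z := by
        filter_upwards [isOpen_ball.mem_nhds hz] with y hy using hφb y hy
      have h2 := h1.deriv_eq
      rw [deriv_comp z (hφ (f z) ⟨z, hz, rfl⟩).differentiableAt (hf z hz).differentiableAt,
        deriv_const_mul _ (hb z hz).differentiableAt] at h2
      rw [mul_comm, mul_assoc, h2, inv_mul_cancel_left₀ hc0]
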